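/- **Conventions.** A pushdown automaton (PDA) is $P=(Q,\Sigma,\Gamma,\delta,q_0,Z_0,F)$ with finite $Q,\Sigma,\Gamma$, $\delta: Q\times(\Sigma\cup\{\varepsilon\})\times\Gamma\to 2^{Q\times\Gamma^{\le 2}}$, $q_0\in Q$, $Z_0\in\Gamma$ and $F\subseteq Q$. A configuration is an element of $Q\times\Gamma^*$; a transition replaces the top stack symbol by a word of length at most two, and there is no transition from an empty stack. $L(P)$ is the set of words $w$ for which some run from $(q_0,Z_0)$ that reads $w$ (with $\varepsilon$-transitions allowed anywhere) ends in a state of $F$. For $k\in\mathbb N$, in the $k$-explorability game on $P$ each of $k$ tokens starts in $(q_0,Z_0)$. In each round Spoiler chooses a letter $a\in\Sigma$, and then Determiner moves each token along a path that consists of finitely many (possibly zero) $\varepsilon$-transitions followed by one transition reading $a$; she must be able to move every token. Determiner wins if, for every finite word $w$ (including the empty word) that is played by Spoiler in the rounds so far and lies in $L(P)$, at least one token is in a state of $F$ right after $w$ has been played. $P$ is $k$-explorable if Determiner has a winning strategy. For a finite alphabet $\Sigma$, $\mathsf{Expl}_k\text{-}\mathsf{CFL}$ is the class of languages $L\subseteq\Sigma^*$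 recognised by $k$-explorable PDAs, and $\mathsf{CFL}$ is the class of context-free languages $L\subseteq\Sigma^*$. **Theorem.** Let $\Sigma$ be a finite alphabet and $k\in\mathbb N=\{0,1,2,\dots\}$. Then $$\mathsf{Expl}_k\text{-}\mathsf{CFL}\subseteq\mathsf{Expl}_{k+1}\text{-}\mathsf{CFL}\subseteq\mathsf{CFL}.$$ If $\Sigma$ has at least two letters, both inclusions are strict: $$\mathsf{Expl}_k\text{-}\mathsf{CFL}\subsetneq\mathsf{Expl}_{k+1}\text{-}\mathsf{CFL}\subsetneq\mathsf{CFL}.$$ Moreover, for any two distinct letters $a,b\in\Sigma$, the language $L=\bigcup_{i=1}^{k+1}\{a^n b^{in}\mid n\in\mathbb N\}$ witnesses the first strict inclusion: $L$ is recognised by a $(k+1)$-explorable PDA, but by no $k$-explorable PDA. -/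

import Mathlib

namespace Explorability

/-- A pushdown automaton with states `Q`, input alphabet `α` and stack alphabet `Γ`.
`δ q (some a) Z` lists the moves that read the letter `a` in the mode `(q, Z)`, and `δ q none Z`
lists the `ε`-moves. A move `(p, β)` goes to state `p` and replaces the top symbol `Z` by the
word `β` of length at most two, whose first symbol becomes the new top. -/
structure PDA (Q α Γ : Type*) where
  δ : Q → Option α → Γ → Set (Q × List Γ)
  push_le_two : ∀ q x Z, ∀ m ∈ δ q x Z, m.2.length ≤ 2
  start : Q
  bottom : Γ
  accept : Set Q

namespace PDA

variable {Q α Γ : Type*} (P : PDA Q α Γ)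

/-- The initial configuration `(q₀, Z₀)`. A configuration is a state together with a stack,
written from the top downwards. -/
def init : Q × List Γ := (P.start, [P.bottom])

/-- One transition, labelled by a letter or by `ε` (`none`).
There is no transition from an empty stack. -/
inductive Step : Option α → Q × List Γ → Q × List Γ → Prop
  | mk (q p : Q) (x : Option α) (Z : Γ) (β γ : List Γ) (h : (p, β) ∈ P.δ q x Z) :
      Step x (q, Z :: γ) (p, β ++ γ)

/-- `P.Run c w d`: there is a run of `P` from `c` to `d` that reads exactly the word `w`
(with `ε`-transitions allowed anywhere, also at the end). -/
inductive Run : Q × List Γ → List α → Q × List Γ → Prop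
  | refl (c : Q × List Γ) : Run c [] c
  | eps {c c' d : Q × List Γ} {w : List α} (h : P.Step none c c') (r : Run c' w d) : Run c w d
  | read {c c' d : Q × List Γ} {a : α} {w : List α} (h : P.Step (some a) c c') (r : Run c' w d) :
      Run c (a :: w) d

/-- The language of `P`, by acceptance in a final state. -/
def language : Language α := {w | ∃ d : Q × List Γ, P.Run P.init w d ∧ d.1 ∈ P.accept}

/-- A legal move of one token when Spoiler plays `a`: finitely many (possibly zero)
`ε`-transitions, followed by one transition that reads `a`. -/
def TokenMove (a : α) (c d : Q × List Γ) : Prop :=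
  ∃ c' : Q × List Γ, Relation.ReflTransGen (P.Step none) c c' ∧ P.Step (some a) c' d

/-- `σ` is a winning strategy for Determiner in the `k`-explorability game on `P`.
Once her strategy is fixed, the history of a play is determined by the letters that Spoiler has
chosen, so a strategy gives, for each finite word played by Spoiler, the positions of the `k` tokens
after that word. All tokens start in the initial configuration, in every round each
of them makes a legal move, and whenever the word played so far is in the language of `P`, some
token is in an accepting state. -/
structure IsWinningStrategy (k : ℕ) (σ : List α → Fin k → Q × List Γ) : Prop where
  init : ∀ l, σ [] l = P.init
  move : ∀ w a l, P.TokenMove a (σ w l) (σ (w ++ [a]) l)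
  wins : ∀ w ∈ P.language, ∃ l, (σ w l).1 ∈ P.accept

/-- `P` is `k`-explorable: Determiner has a winning strategy in the `k`-explorability game. -/
def IsExplorable (k : ℕ) : Prop := ∃ σ : List α → Fin k → Q × List Γ, P.IsWinningStrategy k σ

end PDA

/-- The class of languages over `α` recognised by `k`-explorable pushdown automata
(with finitely many states and stack symbols). -/
def ExplCFL (k : ℕ) (α : Type*) : Set (Language α) :=
  {L | ∃ (Q Γ : Type) (_ : Finite Q) (_ : Finite Γ) (P : PDA Q α Γ),
    P.IsExplorable k ∧ P.language = L}

/-- The class of context-free languages over `α`. -/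
def CFL (α : Type*) : Set (Language α) := {L | L.IsContextFree}

/-- The language `⋃_{i=1}^{m} {aⁿ b^{i n} | n ∈ ℕ}`. -/
def multiplesLanguage {α : Type*} (a b : α) (m : ℕ) : Language α :=
  {w | ∃ i ∈ Finset.Icc 1 m, ∃ n : ℕ, w = List.replicate n a ++ List.replicate (i * n) b}

end Explorability

/-! An extra token can shadow an existing one, so explorability passes from `k` to `k + 1` for `k ≥
1`; for `k = 0` the language must be empty. Every PDA language is context-free by the triple
construction (`mem_language_iff_gen`).

For strictness, `k + 1` tokens can each fix one slope `i` at the first letter and then run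
deterministically (`multiplesPDA`). With only `k` tokens, let Spoiler play `a ^ n b ^ ((k + 1) n)`.
Its prefixes `a ^ n b ^ (i n)` with `1 ≤ i ≤ k + 1` all lie in the language, so by pigeonhole one
token accepts two of them, for some `i < j`, along a single run. `phasePDA` marks the letters read
before and after the first acceptance, so the marked words of such runs form a PDA language. Pumping
in it (`exists_notMem_phasePDA_language`) excludes such a run for a suitable `n`: the `a`s and the
second phase must grow together, but they are separated by more `b`s than the pumped window can
span.

The upper class differs from `CFL` because the next level of the hierarchy already leaves it. -/

namespace Explorability

/-! ### Pumping for grammars with at most two nonterminals per rule. -/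

section BinaryGrammar

variable {N α : Type*}

/-- `Gen R A w`: the nonterminal `A` generates the word `w` by the rules `A → x B₁ … Bᵣ` with
`R A x [B₁, …, Bᵣ]` and `r ≤ 2`, where `x` is a letter or empty. -/
inductive Gen (R : N → Option α → List N → Prop) : N → List α → Prop
  | leaf {A : N} {x : Option α} (h : R A x []) : Gen R A x.toList
  | unary {A B : N} {x : Option α} {w : List α} (h : R A x [B]) (g : Gen R B w) :
      Gen R A (x.toList ++ w)
  | binary {A B C : N} {x : Option α} {w₁ w₂ : List α} (h : R A x [B, C]) (g₁ : Gen R B w₁)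
      (g₂ : Gen R C w₂) : Gen R A (x.toList ++ (w₁ ++ w₂))

variable {R : N → Option α → List N → Prop}

/-- `Embeds R A w B x`: the word `w` has the form `u x z`, and every word generated by `B` becomes,
when put between `u` and `z`, a word generated by `A`. -/
def Embeds (R : N → Option α → List N → Prop) (A : N) (w : List α) (B : N) (x : List α) : Prop :=
  ∃ u z : List α, w = u ++ (x ++ z) ∧ ∀ y, Gen R B y → Gen R A (u ++ (y ++ z))

lemma Embeds.refl (A : N) (w : List α) : Embeds R A w A w :=
  ⟨[], [], by simp, fun y hy => by simpa using hy⟩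

lemma Embeds.trans {A B C : N} {w x y : List α} (h₁ : Embeds R A w B x) (h₂ : Embeds R B x C y) :
    Embeds R A w C y := by
  obtain ⟨u, z, rfl, h⟩ := h₁
  obtain ⟨u', z', rfl, h'⟩ := h₂
  refine ⟨u ++ u', z' ++ z, by simp, fun v hv => ?_⟩
  simpa using h _ (h' v hv)

lemma length_toList_le_one (x : Option α) : x.toList.length ≤ 1 := by
  cases x <;> simp

/-- A long word has a generated factor whose length is prescribed up to a factor of two. -/
lemma Gen.exists_embeds {A : N} {w : List α} (g : Gen R A w) {m : ℕ} (hm : 1 ≤ m)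
    (hw : m ≤ w.length) :
    ∃ B x, Embeds R A w B x ∧ Gen R B x ∧ m ≤ x.length ∧ x.length ≤ 2 * m := by
  induction g with
  | @leaf A x h =>
    have := length_toList_le_one x
    exact ⟨A, _, .refl _ _, .leaf h, hw, by omega⟩
  | @unary A B x w h g ih =>
    have := length_toList_le_one x
    by_cases hl : (x.toList ++ w).length ≤ 2 * m
    · exact ⟨A, _, .refl _ _, .unary h g, hw, hl⟩
    · simp only [List.length_append] at hl
      obtain ⟨C, y, he, hy⟩ := ih (by omega)
      refine ⟨C, y, Embeds.trans ⟨x.toList, [], by simp, fun v hv => ?_⟩ he, hy⟩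
      simpa using Gen.unary h hv
  | @binary A B C x w₁ w₂ h g₁ g₂ ih₁ ih₂ =>
    have := length_toList_le_one x
    by_cases hl : (x.toList ++ (w₁ ++ w₂)).length ≤ 2 * m
    · exact ⟨A, _, .refl _ _, .binary h g₁ g₂, hw, hl⟩
    · simp only [List.length_append] at hl
      by_cases h₁ : m ≤ w₁.length
      · obtain ⟨D, y, he, hy⟩ := ih₁ h₁
        refine ⟨D, y, Embeds.trans ⟨x.toList, w₂, rfl, fun v hv => ?_⟩ he, hy⟩
        exact Gen.binary h hv g₂
      · obtain ⟨D, y, he, hy⟩ := ih₂ (by omega)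
        refine ⟨D, y, Embeds.trans ⟨x.toList ++ w₁, [], by simp, fun v hv => ?_⟩ he, hy⟩
        simpa using Gen.binary h g₁ hv

/-- A long word has a chain of nested generated factors of strictly increasing lengths. -/
lemma Gen.exists_chain (n : ℕ) {A : N} {w : List α} (g : Gen R A w) (hw : 3 ^ n ≤ w.length) :
    ∃ (B : ℕ → N) (x : ℕ → List α),
      (∀ i ≤ n, Embeds R A w (B i) (x i) ∧ Gen R (B i) (x i) ∧ (x i).length ≤ 2 * 3 ^ n) ∧
      ∀ j ≤ n, ∀ i < j, (x i).length < (x j).length ∧ Embeds R (B j) (x j) (B i) (x i) := by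
  induction n generalizing A w with
  | zero =>
    obtain ⟨B, x, he, hg, -, hx⟩ := g.exists_embeds (m := 1) le_rfl (by simpa using hw)
    exact ⟨fun _ => B, fun _ => x, fun i _ => ⟨he, hg, by simpa using hx⟩, fun j hj i hi => by omega⟩
  | succ n ih =>
    -- The length windows from `3 ^ i` to `2 * 3 ^ i` are disjoint, which makes the lengths in the
    -- chain strictly increase.
    obtain ⟨B, x, he, hg, hx, hx'⟩ := g.exists_embeds (Nat.one_le_pow _ _ (by norm_num)) hw
    have hpow : 3 ^ (n + 1) = 3 * 3 ^ n := by ring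
    obtain ⟨B', x', h₁, h₂⟩ := ih hg (by omega)
    have hpos : 0 < 3 ^ n := by positivity
    refine ⟨fun i => if i ≤ n then B' i else B, fun i => if i ≤ n then x' i else x,
      fun i hi => ?_, fun j hj i hi => ?_⟩
    · by_cases hin : i ≤ n
      · obtain ⟨a, b, c⟩ := h₁ i hin
        simp only [hin, if_true]
        exact ⟨he.trans a, b, by omega⟩
      · simp only [hin, if_false]
        exact ⟨he, hg, hx'⟩
    · have hin : i ≤ n := by omega
      by_cases hjn : j ≤ n
      · simpa only [hin, hjn, if_true] using h₂ j hjn i hi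
      · obtain ⟨a, b, c⟩ := h₁ i hin
        simp only [hin, hjn, if_true, if_false]
        exact ⟨by omega, a⟩

/-- The pumping lemma. -/
theorem Gen.pumping [Finite N] (R : N → Option α → List N → Prop) :
    ∃ p : ℕ, ∀ (A : N) (w : List α), Gen R A w → p ≤ w.length →
      ∃ u v x y z : List α, w = u ++ (v ++ (x ++ (y ++ z))) ∧ 0 < (v ++ y).length ∧
        (v ++ (x ++ y)).length ≤ p ∧
        ∀ t : ℕ, Gen R A
          (u ++ ((List.replicate t v).flatten ++ (x ++ ((List.replicate t y).flatten ++ z)))) := by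
  refine ⟨2 * 3 ^ Nat.card N, fun A w g hw => ?_⟩
  obtain ⟨B, x, h₁, h₂⟩ := g.exists_chain (Nat.card N) (by omega)
  -- Pigeonhole on nonterminals. The repeated ones generate factors of different lengths, so the
  -- pumped part is nonempty even if the rules have cycles that produce no letter.
  obtain ⟨i, j, hij, hj, hB⟩ : ∃ i j, i < j ∧ j ≤ Nat.card N ∧ B i = B j := by
    have : Fintype N := Fintype.ofFinite N
    obtain ⟨i, j, hne, h⟩ := Fintype.exists_ne_map_eq_of_card_lt
      (fun i : Fin (Nat.card N + 1) => B i) (by simp)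
    rcases lt_or_gt_of_ne hne with hlt | hlt
    · exact ⟨i, j, hlt, by omega, h⟩
    · exact ⟨j, i, hlt, by omega, h.symm⟩
  obtain ⟨hlt, v, y, hxj, hpump⟩ := h₂ j hj i hij
  obtain ⟨⟨u, z, rfl, hout⟩, -, hlen⟩ := h₁ j hj
  obtain ⟨-, hgi, -⟩ := h₁ i (by omega)
  refine ⟨u, v, x i, y, z, by simp [hxj], ?_, by rwa [← hxj], fun t => ?_⟩
  · rw [hxj] at hlt
    simp only [List.length_append] at hlt ⊢
    omega
  · have key : Gen R (B j) ((List.replicate t v).flatten ++ (x i ++ (List.replicate t y).flatten)) := by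
      induction t with
      | zero => simpa [hB] using hgi
      | succ t ih =>
        have := hpump _ (hB ▸ ih)
        rw [List.replicate_succ, List.replicate_succ']
        simpa using this
    simpa using hout _ key

end BinaryGrammar

/-! ### Translation into Mathlib's context-free grammars. -/

section ContextFree

variable {N : Type} {α : Type*}

/-- A sentential form generates a word if its symbols generate consecutive factors of it. -/
inductive FormGen (R : N → Option α → List N → Prop) : List (Symbol α N) → List α → Prop
  | nil : FormGen R [] []
  | terminal {a : α} {s : List (Symbol α N)} {w : List α} (h : FormGen R s w) :
      FormGen R (.terminal a :: s) (a :: w)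
  | nonterminal {A : N} {s : List (Symbol α N)} {v w : List α} (g : Gen R A v)
      (h : FormGen R s w) : FormGen R (.nonterminal A :: s) (v ++ w)

variable {R : N → Option α → List N → Prop}

/-- The right-hand side `x B₁ … Bᵣ` of a rule. -/
def ruleOutput (x : Option α) (l : List N) : List (Symbol α N) :=
  x.toList.map .terminal ++ l.map .nonterminal

lemma FormGen.map_terminal (w : List α) : FormGen R (w.map .terminal) w := by
  induction w with
  | nil => exact .nil
  | cons a w ih => exact .terminal ih

lemma FormGen.of_map_terminal {s : List (Symbol α N)} {w : List α} (h : FormGen R s w) :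
    ∀ v : List α, s = v.map .terminal → w = v := by
  induction h with
  | nil =>
    rintro (_ | ⟨b, v⟩) hv
    · rfl
    · simp at hv
  | terminal h ih =>
    rintro (_ | ⟨b, v⟩) hv <;> simp only [List.map_nil, List.map_cons, reduceCtorEq,
      List.cons.injEq, Symbol.terminal.injEq] at hv
    rw [ih v hv.2, hv.1]
  | nonterminal g h ih =>
    rintro (_ | ⟨b, v⟩) hv <;> simp at hv

lemma FormGen.append_inv {s t : List (Symbol α N)} {w : List α} (h : FormGen R (s ++ t) w) :
    ∃ w₁ w₂, w = w₁ ++ w₂ ∧ FormGen R s w₁ ∧ FormGen R t w₂ := by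
  induction s generalizing w with
  | nil => exact ⟨[], w, rfl, .nil, h⟩
  | cons X s ih =>
    cases h with
    | terminal h =>
      obtain ⟨w₁, w₂, rfl, h₁, h₂⟩ := ih h
      exact ⟨_, w₂, rfl, .terminal h₁, h₂⟩
    | nonterminal g h =>
      obtain ⟨w₁, w₂, rfl, h₁, h₂⟩ := ih h
      exact ⟨_, w₂, by simp, .nonterminal g h₁, h₂⟩

lemma FormGen.append {s t : List (Symbol α N)} {w₁ w₂ : List α} (h₁ : FormGen R s w₁)
    (h₂ : FormGen R t w₂) : FormGen R (s ++ t) (w₁ ++ w₂) := by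
  induction h₁ with
  | nil => exact h₂
  | terminal h ih => exact .terminal ih
  | nonterminal g h ih => simpa using FormGen.nonterminal g ih

lemma FormGen.gen_of_ruleOutput {A : N} {x : Option α} {l : List N} {w : List α}
    (hl : l.length ≤ 2) (hR : R A x l) (h : FormGen R (ruleOutput x l) w) : Gen R A w := by
  obtain ⟨w₁, w₂, rfl, h₁, h₂⟩ := h.append_inv
  obtain rfl := h₁.of_map_terminal _ rfl
  match l, hl with
  | [], _ =>
    replace h₂ : FormGen R [] w₂ := h₂
    cases h₂
    simpa using Gen.leaf hR
  | [B], _ =>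
    replace h₂ : FormGen R [.nonterminal B] w₂ := h₂
    cases h₂ with
    | nonterminal g hs =>
      cases hs
      simpa using Gen.unary hR g
  | [B, C], _ =>
    replace h₂ : FormGen R [.nonterminal B, .nonterminal C] w₂ := h₂
    cases h₂ with
    | nonterminal g hs =>
      cases hs with
      | nonterminal g' hs =>
        cases hs
        simpa using Gen.binary hR g g'

variable [Finite N] [Finite α]

/-- `Gen` only ever uses right-hand sides with at most two nonterminals, so this truncation of `R`
loses nothing. -/
lemma finite_rules (R : N → Option α → List N → Prop) :
    {r : ContextFreeRule α N | ∃ x l, l.length ≤ 2 ∧ R r.input x l ∧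
      r.output = ruleOutput x l}.Finite := by
  have hl : {l : List N | l.length ≤ 2}.Finite := List.finite_length_le N 2
  refine (((Set.finite_univ (α := N)).prod ((Set.finite_univ (α := Option α)).prod hl)).image
    (fun q => (⟨q.1, ruleOutput q.2.1 q.2.2⟩ : ContextFreeRule α N))).subset ?_
  rintro ⟨A, o⟩ ⟨x, l, h, -, ho⟩
  exact ⟨(A, x, l), ⟨trivial, trivial, h⟩, by simp only at ho; simp [ho]⟩

/-- The context-free grammar with the rules `R` and the initial nonterminal `S`. -/
noncomputable def toCFG (R : N → Option α → List N → Prop) (S : N) : ContextFreeGrammar α where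
  NT := N
  initial := S
  rules := (finite_rules R).toFinset

lemma mem_rules_toCFG {S : N} {r : ContextFreeRule α N} :
    r ∈ (toCFG R S).rules ↔ ∃ x l, l.length ≤ 2 ∧ R r.input x l ∧ r.output = ruleOutput x l :=
  (finite_rules R).mem_toFinset

lemma derives_ruleOutput (S : N) {A : N} {x : Option α} {l : List N} (hl : l.length ≤ 2)
    (hR : R A x l) : (toCFG R S).Derives [.nonterminal A] (ruleOutput x l) :=
  ContextFreeGrammar.Produces.single ⟨⟨A, ruleOutput x l⟩,
    mem_rules_toCFG.2 ⟨x, l, hl, hR, rfl⟩, ContextFreeRule.Rewrites.input_output⟩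

lemma Gen.derives (S : N) {A : N} {w : List α} (g : Gen R A w) :
    (toCFG R S).Derives [.nonterminal A] (w.map .terminal) := by
  induction g with
  | @leaf A x h =>
    have : (toCFG R S).Derives [.nonterminal A] (x.toList.map .terminal ++ []) :=
      derives_ruleOutput S (by simp) h
    rwa [List.append_nil] at this
  | unary h g ih =>
    refine (derives_ruleOutput S (by simp) h).trans ?_
    rw [List.map_append]
    exact ih.append_left _
  | @binary A B C x w₁ w₂ h g₁ g₂ ih₁ ih₂ =>
    refine (derives_ruleOutput S (by simp) h).trans ?_
    rw [List.map_append, List.map_append]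
    exact ((ih₁.append_right _).trans (ih₂.append_left _)).append_left _

/-- Generation is pulled back along the derivation from its end: undoing a production merges the
factors of a right-hand side into one factor generated by the left-hand side. -/
lemma FormGen.of_derives {S : N} {s t : List (Symbol α N)} (h : (toCFG R S).Derives s t)
    {w : List α} (ht : FormGen R t w) : FormGen R s w := by
  induction h using Relation.ReflTransGen.head_induction_on with
  | refl => exact ht
  | head h _ ih =>
    obtain ⟨r, hr, hs⟩ := h
    obtain ⟨p, q, rfl, rfl⟩ := hs.exists_parts
    obtain ⟨x, l, hl, hR, ho⟩ := mem_rules_toCFG.1 hr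
    obtain ⟨w₁₂, w₃, rfl, h₁₂, h₃⟩ := ih.append_inv
    obtain ⟨w₁, w₂, rfl, h₁, h₂⟩ := h₁₂.append_inv
    rw [ho] at h₂
    have := FormGen.nonterminal (h₂.gen_of_ruleOutput hl hR) FormGen.nil
    rw [List.append_nil] at this
    exact List.append_assoc w₁ w₂ w₃ ▸ (h₁.append this).append h₃

theorem isContextFree_gen (R : N → Option α → List N → Prop) (S : N) :
    Language.IsContextFree ({w | Gen R S w} : Language α) := by
  refine ⟨toCFG R S, Set.ext fun w => ⟨fun h => ?_, fun h => ?_⟩⟩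
  · have : FormGen R [.nonterminal S] w := FormGen.of_derives h (FormGen.map_terminal w)
    cases this with
    | nonterminal g hs =>
      cases hs
      simpa using g
  · exact Gen.derives S h

end ContextFree

/-! ### Pushdown languages are context-free and can be pumped. -/

namespace PDA

variable {Q α Γ : Type*} {P : PDA Q α Γ}

lemma Step.exists_cons {x : Option α} {c d : Q × List Γ} (h : P.Step x c d) :
    ∃ q Z γ p β, c = (q, Z :: γ) ∧ d = (p, β ++ γ) ∧ (p, β) ∈ P.δ q x Z := by
  cases h with
  | mk q p x Z β γ h => exact ⟨q, Z, γ, p, β, rfl, rfl, h⟩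

lemma Step.run {x : Option α} {c d e : Q × List Γ} {w : List α} (h : P.Step x c d)
    (r : P.Run d w e) : P.Run c (x.toList ++ w) e := by
  cases x with
  | none => exact .eps h r
  | some a => exact .read h r

lemma Run.trans {c d e : Q × List Γ} {v w : List α} (r : P.Run c v d) (s : P.Run d w e) :
    P.Run c (v ++ w) e := by
  induction r with
  | refl => exact s
  | eps h _ ih => exact .eps h (ih s)
  | read h _ ih => exact .read h (ih s)

lemma Run.stack_ne_nil {c d : Q × List Γ} {w : List α} (r : P.Run c w d) (hw : w ≠ []) :
    c.2 ≠ [] := by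
  cases r with
  | refl => exact absurd rfl hw
  | eps h _ => obtain ⟨q, Z, γ, p, β, rfl, -, -⟩ := h.exists_cons; simp
  | read h _ => obtain ⟨q, Z, γ, p, β, rfl, -, -⟩ := h.exists_cons; simp

lemma TokenMove.run {a : α} {c d : Q × List Γ} (h : P.TokenMove a c d) : P.Run c [a] d := by
  obtain ⟨c', he, hs⟩ := h
  induction he using Relation.ReflTransGen.head_induction_on with
  | refl => exact .read hs (.refl _)
  | head h _ ih => exact .eps h ih

/-- The rules of a grammar for the runs of `P`. The nonterminal `(q, Z, some p)` generates the words
that are read by the runs from `(q, [Z])` to `(p, [])`, and `(q, Z, none)` those that are read by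
the runs from `(q, [Z])` to an accepting state. -/
inductive RunRule (P : PDA Q α Γ) :
    Q × Γ × Option Q → Option α → List (Q × Γ × Option Q) → Prop
  | accept {q : Q} {Z : Γ} (h : q ∈ P.accept) : RunRule P (q, Z, none) none []
  | emptied {q p : Q} {Z : Γ} (h : p ∈ P.accept) : RunRule P (q, Z, none) none [(q, Z, some p)]
  | pop {q p : Q} {x : Option α} {Z : Γ} (h : (p, []) ∈ P.δ q x Z) : RunRule P (q, Z, some p) x []
  | swap {q p : Q} {x : Option α} {Y Z : Γ} {r : Option Q} (h : (p, [Y]) ∈ P.δ q x Z) :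
      RunRule P (q, Z, r) x [(p, Y, r)]
  | push {q p p' : Q} {x : Option α} {X Y Z : Γ} {r : Option Q} (h : (p, [X, Y]) ∈ P.δ q x Z) :
      RunRule P (q, Z, r) x [(p, X, some p'), (p', Y, r)]
  | push_accept {q p : Q} {x : Option α} {X Y Z : Γ} (h : (p, [X, Y]) ∈ P.δ q x Z) :
      RunRule P (q, Z, none) x [(p, X, none)]

/-- `StackGen P q γ w`: the grammar of `RunRule` generates `w` as the word of a run from `(q, γ)` to
an accepting state. -/
inductive StackGen (P : PDA Q α Γ) : Q → List Γ → List α → Prop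
  | nil {q : Q} (h : q ∈ P.accept) : StackGen P q [] []
  | accept {q : Q} {Z : Γ} {γ : List Γ} {w : List α} (g : Gen P.RunRule (q, Z, none) w) :
      StackGen P q (Z :: γ) w
  | pop {q p : Q} {Z : Γ} {γ : List Γ} {v w : List α} (g : Gen P.RunRule (q, Z, some p) v)
      (h : StackGen P p γ w) : StackGen P q (Z :: γ) (v ++ w)

lemma StackGen.step {q p : Q} {x : Option α} {Z : Γ} {β γ : List Γ} {w : List α}
    (hm : (p, β) ∈ P.δ q x Z) (h : StackGen P p (β ++ γ) w) :
    StackGen P q (Z :: γ) (x.toList ++ w) := by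
  match β, P.push_le_two _ _ _ _ hm with
  | [], _ => exact .pop (.leaf (.pop hm)) h
  | [Y], _ =>
    cases h with
    | accept g => exact .accept (.unary (.swap hm) g)
    | pop g h => simpa using StackGen.pop (.unary (.swap hm) g) h
  | [X, Y], _ =>
    cases h with
    | accept g => exact .accept (.unary (.push_accept hm) g)
    | pop g h =>
      cases h with
      | accept g' => exact .accept (.binary (.push hm) g g')
      | pop g' h => simpa using StackGen.pop (.binary (.push hm) g g') h

lemma Run.stackGen {c d : Q × List Γ} {w : List α} (r : P.Run c w d) (hd : d.1 ∈ P.accept) :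
    StackGen P c.1 c.2 w := by
  have step : ∀ {x : Option α} {c d : Q × List Γ} {w : List α}, P.Step x c d →
      StackGen P d.1 d.2 w → StackGen P c.1 c.2 (x.toList ++ w) := by
    intro x c d w h hw
    obtain ⟨q, Z, γ, p, β, rfl, rfl, hm⟩ := h.exists_cons
    exact StackGen.step hm hw
  induction r with
  | refl c =>
    obtain ⟨q, _ | ⟨Z, γ⟩⟩ := c
    · exact .nil hd
    · exact StackGen.accept (.leaf (RunRule.accept hd))
  | eps h _ ih => exact step h (ih hd)
  | read h _ ih => exact step h (ih hd)

/-- The arbitrary lower stack `γ` is needed for push moves, where the first subrun takes place above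
the second pushed symbol. -/
lemma run_of_gen {A : Q × Γ × Option Q} {w : List α} (g : Gen P.RunRule A w) (γ : List Γ) :
    ∃ d : Q × List Γ, P.Run (A.1, A.2.1 :: γ) w d ∧ (∀ p ∈ A.2.2, d = (p, γ)) ∧
      (A.2.2 = none → d.1 ∈ P.accept) := by
  induction g generalizing γ with
  | leaf h =>
    cases h with
    | accept h => exact ⟨_, .refl _, by simp, fun _ => h⟩
    | pop h =>
      refine ⟨_, by simpa using (Step.mk _ _ _ _ _ γ h).run (.refl _), by simp, by simp⟩
  | unary h g ih =>
    cases h with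
    | emptied h =>
      obtain ⟨d, r, h₁, h₂⟩ := ih γ
      obtain rfl := h₁ _ rfl
      exact ⟨_, r, by simp, fun _ => h⟩
    | swap h =>
      obtain ⟨d, r, hd⟩ := ih γ
      exact ⟨d, (Step.mk _ _ _ _ _ γ h).run r, hd⟩
    | @push_accept _ _ _ _ Y _ h =>
      obtain ⟨d, r, h₁, h₂⟩ := ih (Y :: γ)
      exact ⟨d, (Step.mk _ _ _ _ _ γ h).run r, by simp, h₂⟩
  | binary h g₁ g₂ ih₁ ih₂ =>
    cases h with
    | @push _ _ _ _ _ Y _ _ h =>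
      obtain ⟨c, r, h₁, -⟩ := ih₁ (Y :: γ)
      obtain rfl := h₁ _ rfl
      obtain ⟨d, s, hd⟩ := ih₂ γ
      exact ⟨d, (Step.mk _ _ _ _ _ γ h).run (r.trans s), hd⟩

theorem mem_language_iff_gen {w : List α} :
    w ∈ P.language ↔ Gen P.RunRule (P.start, P.bottom, none) w := by
  constructor
  · rintro ⟨d, r, hd⟩
    cases r.stackGen hd with
    | accept g => exact g
    | pop g h =>
      cases h with
      | nil h =>
        -- This run accepts after emptying the stack, which the rule `emptied` covers.
        rw [List.append_nil]
        exact Gen.unary (.emptied h) g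
  · intro g
    obtain ⟨d, r, -, hd⟩ := run_of_gen g []
    exact ⟨d, r, hd rfl⟩

theorem isContextFree_language {Q Γ : Type} [Finite Q] [Finite Γ] [Finite α] (P : PDA Q α Γ) :
    P.language.IsContextFree := by
  have h : P.language = {w | Gen P.RunRule (P.start, P.bottom, none) w} :=
    Set.ext fun w => mem_language_iff_gen
  rw [h]
  exact isContextFree_gen _ _

theorem pumping [Finite Q] [Finite Γ] (P : PDA Q α Γ) :
    ∃ p : ℕ, ∀ w ∈ P.language, p ≤ w.length →
      ∃ u v x y z : List α, w = u ++ (v ++ (x ++ (y ++ z))) ∧ 0 < (v ++ y).length ∧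
        (v ++ (x ++ y)).length ≤ p ∧
        ∀ t : ℕ,
          u ++ ((List.replicate t v).flatten ++ (x ++ ((List.replicate t y).flatten ++ z))) ∈
            P.language := by
  obtain ⟨p, hp⟩ := Gen.pumping P.RunRule
  refine ⟨p, fun w hw hl => ?_⟩
  obtain ⟨u, v, x, y, z, h₁, h₂, h₃, h₄⟩ := hp _ w (mem_language_iff_gen.1 hw) hl
  exact ⟨u, v, x, y, z, h₁, h₂, h₃, fun t => mem_language_iff_gen.2 (h₄ t)⟩

end PDA

/-! ### The two inclusions. -/

section Monotone

variable {α : Type*}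

lemma PDA.IsExplorable.succ {Q Γ : Type*} {P : PDA Q α Γ} {k : ℕ} (h : P.IsExplorable (k + 1)) :
    P.IsExplorable (k + 2) := by
  obtain ⟨σ, hσ⟩ := h
  -- The new token `0` copies the old token `0`; token `l.succ` plays as the old `l`.
  refine ⟨fun w l => σ w (Fin.cases 0 id l), fun l => hσ.init _, fun w a l => hσ.move w a _,
    fun w hw => ?_⟩
  obtain ⟨l, hl⟩ := hσ.wins w hw
  exact ⟨l.succ, hl⟩

/-- A pushdown automaton that can always move and accepts nothing. -/
def rejectingPDA (α : Type*) : PDA Unit α Unit where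
  δ _ x _ := {m | x.isSome ∧ m = ((), [()])}
  push_le_two := by rintro q x Z m ⟨-, rfl⟩; simp
  start := ()
  bottom := ()
  accept := ∅

lemma zero_mem_ExplCFL_one : (0 : Language α) ∈ ExplCFL 1 α := by
  have h : (rejectingPDA α).language = 0 := by
    refine Set.eq_empty_iff_forall_notMem.2 ?_
    rintro w ⟨d, -, hd⟩
    exact hd
  refine ⟨Unit, Unit, inferInstance, inferInstance, rejectingPDA α,
    ⟨fun _ _ => (rejectingPDA α).init, fun _ => rfl, fun w a l => ⟨_, .refl, ?_⟩, ?_⟩, h⟩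
  · exact PDA.Step.mk (P := rejectingPDA α) () () (some a) () [()] [] ⟨rfl, rfl⟩
  · intro w hw
    rw [h] at hw
    exact hw.elim

/-- Level `0` is separate: there is no token to copy, and `P` itself may get stuck, so another
automaton for the empty language is used. -/
theorem ExplCFL_subset_succ (k : ℕ) (α : Type*) : ExplCFL k α ⊆ ExplCFL (k + 1) α := by
  rintro L ⟨Q, Γ, hQ, hΓ, P, hP, rfl⟩
  cases k with
  | zero =>
    obtain ⟨σ, hσ⟩ := hP
    have : P.language = 0 :=
      Set.eq_empty_iff_forall_notMem.2 fun w hw => (hσ.wins w hw).choose.elim0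
    rw [this]
    exact zero_mem_ExplCFL_one
  | succ k => exact ⟨Q, Γ, hQ, hΓ, P, hP.succ, rfl⟩

theorem ExplCFL_subset_CFL [Finite α] (k : ℕ) : ExplCFL k α ⊆ CFL α := by
  rintro L ⟨Q, Γ, hQ, hΓ, P, -, rfl⟩
  exact P.isContextFree_language

end Monotone

/-! ### A `(k + 1)`-explorable automaton for the witness language. -/

section MultiplesPDA

/-- The states of `multiplesPDA`. -/
inductive MState
  | start | push | pop | done | dead
  deriving DecidableEq

open MState

instance : Finite MState :=
  Set.finite_univ_iff.1 ((Set.toFinite {start, push, pop, done, dead}).subset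
    (by rintro ⟨⟩ - <;> simp))

variable {α : Type*} [DecidableEq α] (a b : α) {k : ℕ}

/-- The move of `multiplesPDA` when the letter `x` is read in the mode `(q, Z)`, where `i` is the
guess made at the start. A symbol `(s, c)` on the stack stands for `c + 1` letters `b` that are still
to be read; `s` marks the lowest symbol. -/
def mMove (i : Fin (k + 1)) (q : MState) (x : α) (Z : Bool × Fin (k + 1)) :
    MState × List (Bool × Fin (k + 1)) :=
  if x = a ∧ q = start then (push, [(true, i)])
  else if x = a ∧ q = push then (push, [(false, Z.2), Z])
  else if x = b ∧ (q = push ∨ q = pop) then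
    if Z.2 = 0 then if Z.1 then (done, [Z]) else (pop, [])
    else (pop, [(Z.1, Z.2 - 1)])
  else (dead, [Z])

/-- A pushdown automaton that guesses `i ≤ k` at the start and then accepts deterministically the
words `aⁿ b^{(i + 1) n}`. -/
def multiplesPDA (k : ℕ) : PDA MState α (Bool × Fin (k + 1)) where
  δ q x Z := {m | ∃ (i : Fin (k + 1)) (y : α), x = some y ∧ m = mMove a b i q y Z}
  push_le_two := by
    rintro q x Z m ⟨i, y, -, rfl⟩
    unfold mMove
    split_ifs <;> simp
  start := start
  bottom := (true, 0)
  accept := {start, done}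

/-- The transition of `multiplesPDA` with guess `i`. -/
def mStep (i : Fin (k + 1)) (c : MState × List (Bool × Fin (k + 1))) (x : α) :
    MState × List (Bool × Fin (k + 1)) :=
  match c with
  | (q, []) => (q, [])
  | (q, Z :: γ) => ((mMove a b i q x Z).1, (mMove a b i q x Z).2 ++ γ)

/-- The stack symbols with remaining `c`, above `n` full ones. -/
def mStack (i : Fin (k + 1)) : ℕ → Fin (k + 1) → List (Bool × Fin (k + 1))
  | 0, c => [(true, c)]
  | n + 1, c => (false, c) :: mStack i n i

variable {a b}

lemma foldl_dead (i : Fin (k + 1)) (w : List α) (γ : List (Bool × Fin (k + 1))) :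
    (w.foldl (mStep a b i) (dead, γ)).1 = dead := by
  induction w generalizing γ with
  | nil => rfl
  | cons x w ih => cases γ <;> simp [mStep, mMove, ih]

lemma foldl_done (i : Fin (k + 1)) (w : List α) (Z : Bool × Fin (k + 1))
    (γ : List (Bool × Fin (k + 1))) :
    (w.foldl (mStep a b i) (done, Z :: γ)).1 ∈ ({start, done} : Set MState) ↔ w = [] := by
  cases w with
  | nil => simp
  | cons x w => simp [mStep, mMove, foldl_dead]

lemma mStep_read_pop (hab : a ≠ b) (i c : Fin (k + 1)) (n : ℕ) {q : MState}
    (hq : q = push ∨ q = pop) :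
    mStep a b i (q, mStack i n c) b =
      if c = 0 then if n = 0 then (done, mStack i 0 c) else (pop, mStack i (n - 1) i)
      else (pop, mStack i n (c - 1)) := by
  have hq' : q ≠ start := by rcases hq with rfl | rfl <;> simp
  cases n <;> by_cases hc : c = 0 <;> simp [mStep, mMove, mStack, hab.symm, hq, hc]

/-- The top symbol is worth `c + 1` letters `b`, and each of the `n` symbols below it `i + 1`. -/
lemma foldl_pop (hab : a ≠ b) (i : Fin (k + 1)) (w : List α) (n : ℕ) (c : Fin (k + 1)) :
    (w.foldl (mStep a b i) (pop, mStack i n c)).1 ∈ ({start, done} : Set MState) ↔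
      w = List.replicate (n * (i + 1) + c + 1) b := by
  induction w generalizing n c with
  | nil => simp [List.replicate_succ]
  | cons x w ih =>
    rw [List.foldl_cons, List.replicate_succ, List.cons.injEq]
    by_cases hx : x = b
    · subst hx
      rw [mStep_read_pop hab i c n (.inr rfl)]
      by_cases hc : c = 0
      · cases n with
        | zero => simpa [hc, mStack] using foldl_done i w (true, 0) []
        | succ n =>
          simp only [hc, if_true, Nat.succ_ne_zero, if_false, Nat.add_sub_cancel, ih, true_and]
          rw [show n * (i + 1) + i + 1 = (n + 1) * (i + 1) + ((0 : Fin (k + 1)) : ℕ) by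
            simp; ring]
      · have hc' : (c : ℕ) ≠ 0 := fun h => hc (Fin.ext h)
        simp only [hc, if_false, ih, true_and]
        rw [Fin.val_sub_one_of_ne_zero hc, add_assoc (n * _), Nat.sub_add_cancel (by omega)]
    · have : mStep a b i (pop, mStack i n c) x = (dead, mStack i n c) := by
        cases n <;> simp [mStep, mMove, mStack, hx]
      simp [this, foldl_dead, hx]

lemma foldl_push (hab : a ≠ b) (i : Fin (k + 1)) (w : List α) (n : ℕ) :
    (w.foldl (mStep a b i) (push, mStack i n i)).1 ∈ ({start, done} : Set MState) ↔
      ∃ m : ℕ, w = List.replicate m a ++ List.replicate ((n + m + 1) * (i + 1)) b := by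
  induction w generalizing n with
  | nil => simp
  | cons x w ih =>
    by_cases hxa : x = a
    · subst hxa
      have : mStep x b i (push, mStack i n i) x = (push, mStack i (n + 1) i) := by
        cases n <;> simp [mStep, mMove, mStack]
      rw [List.foldl_cons, this, ih]
      constructor
      · rintro ⟨m, rfl⟩
        exact ⟨m + 1, by rw [List.replicate_succ, show n + 1 + m = n + (m + 1) by ring]; rfl⟩
      · rintro ⟨_ | m, h⟩
        · rw [show (n + 0 + 1) * ((i : ℕ) + 1) = ((n + 1) * i + n) + 1 by ring,
            List.replicate_succ] at h
          simp [hab] at h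
        · rw [List.replicate_succ, List.cons_append, List.cons.injEq] at h
          exact ⟨m, by rw [h.2, show n + 1 + m = n + (m + 1) by ring]⟩
    · have hm : ∀ m : ℕ, x :: w = List.replicate m a ++ List.replicate ((n + m + 1) * (i + 1)) b →
          m = 0 := by
        rintro (_ | m) h
        · rfl
        · simp [List.replicate_succ, hxa] at h
      have h₁ : (∃ m : ℕ, x :: w = List.replicate m a ++ List.replicate ((n + m + 1) * (i + 1)) b) ↔
          ((x :: w).foldl (mStep a b i) (pop, mStack i n i)).1 ∈ ({start, done} : Set MState) := by
        rw [foldl_pop hab, show n * (i + 1) + i + 1 = (n + 0 + 1) * ((i : ℕ) + 1) by ring]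
        exact ⟨fun ⟨m, h⟩ => by obtain rfl := hm m h; exact h, fun h => ⟨0, h⟩⟩
      rw [h₁, List.foldl_cons, List.foldl_cons]
      -- On a letter other than `a` the states `push` and `pop` behave alike, so the count from
      -- `foldl_pop` applies.
      have h₂ : mStep a b i (push, mStack i n i) x = mStep a b i (pop, mStack i n i) x := by
        cases n <;> simp [mStep, mMove, mStack, hxa]
      rw [h₂]

lemma foldl_start (hab : a ≠ b) (i : Fin (k + 1)) (w : List α) :
    (w.foldl (mStep a b i) (multiplesPDA a b k).init).1 ∈ (multiplesPDA a b k).accept ↔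
      ∃ n : ℕ, w = List.replicate n a ++ List.replicate ((i + 1) * n) b := by
  change (w.foldl (mStep a b i) (start, [(true, 0)])).1 ∈ ({start, done} : Set MState) ↔ _
  cases w with
  | nil => simp
  | cons x w =>
    by_cases hxa : x = a
    · subst hxa
      have : mStep x b i (start, [(true, 0)]) x = (push, mStack i 0 i) := by
        simp [mStep, mMove, mStack]
      rw [List.foldl_cons, this, foldl_push hab]
      constructor
      · rintro ⟨m, rfl⟩
        exact ⟨m + 1, by rw [List.replicate_succ, zero_add, mul_comm]; rfl⟩
      · rintro ⟨_ | m, h⟩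
        · simp at h
        · rw [List.replicate_succ, List.cons_append, List.cons.injEq] at h
          exact ⟨m, by rw [h.2, zero_add, mul_comm]⟩
    · have : mStep a b i (start, [(true, 0)]) x = (dead, [(true, 0)]) := by
        simp [mStep, mMove, hxa]
      rw [List.foldl_cons, this, foldl_dead]
      refine iff_of_false (by simp) ?_
      rintro ⟨_ | m, h⟩ <;> simp [List.replicate_succ, hxa] at h

lemma mMove_eq (i j : Fin (k + 1)) {q : MState} (hq : q ≠ start) (x : α)
    (Z : Bool × Fin (k + 1)) : mMove a b i q x Z = mMove a b j q x Z := by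
  simp [mMove, hq]

lemma mMove_ne_start (i : Fin (k + 1)) (q : MState) (x : α) (Z : Bool × Fin (k + 1)) :
    (mMove a b i q x Z).1 ≠ start := by
  unfold mMove
  split_ifs <;> simp

/-- The guess matters only in state `start`, which no move re-enters. The second conjunct lets the
induction continue with the guess of the first step. -/
lemma multiplesPDA_run {c d : MState × List (Bool × Fin (k + 1))} {w : List α}
    (r : (multiplesPDA a b k).Run c w d) :
    ∃ i, d = w.foldl (mStep a b i) c ∧ (c.1 ≠ start → ∀ j, d = w.foldl (mStep a b j) c) := by
  induction r with
  | refl => exact ⟨0, rfl, fun _ _ => rfl⟩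
  | eps h _ _ =>
    obtain ⟨q, Z, γ, p, β, -, -, i, y, hy, -⟩ := h.exists_cons
    simp at hy
  | @read c c' d y w h _ ih =>
    obtain ⟨q, Z, γ, p, β, rfl, rfl, i, y, hy, hm⟩ := h.exists_cons
    obtain rfl := Option.some.inj hy
    obtain ⟨-, -, ih⟩ := ih
    obtain rfl : p = _ := congrArg Prod.fst hm
    obtain rfl : β = _ := congrArg Prod.snd hm
    refine ⟨i, ih (mMove_ne_start _ _ _ _) i, fun hq j => ?_⟩
    rw [ih (mMove_ne_start _ _ _ _) j, List.foldl_cons]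
    simp only [mStep, mMove_eq i j hq]

lemma mStep_step (i : Fin (k + 1)) {c : MState × List (Bool × Fin (k + 1))} (hc : c.2 ≠ [])
    (x : α) : (multiplesPDA a b k).Step (some x) c (mStep a b i c x) := by
  obtain ⟨q, _ | ⟨Z, γ⟩⟩ := c
  · exact absurd rfl hc
  · exact .mk _ _ _ _ _ _ ⟨i, x, rfl, rfl⟩

/-- The marked lowest symbol may change but is never popped, so a token always has a legal move. -/
lemma foldl_stack_ne_nil (i : Fin (k + 1)) (w : List α) :
    (w.foldl (mStep a b i) (multiplesPDA a b k).init).2 ≠ [] := by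
  suffices h : ∀ c : MState × List (Bool × Fin (k + 1)),
      (∃ γ s, c.2 = γ ++ [(true, s)]) →
      ∃ γ s, (w.foldl (mStep a b i) c).2 = γ ++ [(true, s)] by
    obtain ⟨γ, s, h⟩ := h (multiplesPDA a b k).init ⟨[], 0, rfl⟩
    simp [h]
  induction w with
  | nil => exact fun c h => h
  | cons x w ih =>
    rintro ⟨q, γ⟩ ⟨γ', s, h⟩
    refine ih _ ?_
    simp only at h
    subst h
    rcases γ' with _ | ⟨Z, γ'⟩
    · simp only [List.nil_append, mStep, mMove]
      split_ifs
      · exact ⟨[], i, rfl⟩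
      · exact ⟨[(false, s)], s, rfl⟩
      · exact ⟨[], s, rfl⟩
      · exact ⟨[], s - 1, rfl⟩
      · exact ⟨[], s, rfl⟩
    · exact ⟨(mMove a b i q x Z).2 ++ γ', s, by simp [mStep]⟩

lemma multiplesPDA_language (hab : a ≠ b) :
    (multiplesPDA a b k).language = multiplesLanguage a b (k + 1) := by
  ext w
  constructor
  · rintro ⟨d, r, hd⟩
    obtain ⟨i, rfl, -⟩ := multiplesPDA_run r
    obtain ⟨n, h⟩ := (foldl_start hab i w).1 hd
    exact ⟨i + 1, by simp; omega, n, h⟩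
  · rintro ⟨i, hi, n, h⟩
    obtain ⟨hi₁, hi₂⟩ := Finset.mem_Icc.1 hi
    obtain ⟨i, rfl⟩ := Nat.exists_eq_add_of_le' hi₁
    refine ⟨w.foldl (mStep a b ⟨i, by omega⟩) (multiplesPDA a b k).init, ?_,
      (foldl_start hab ⟨i, by omega⟩ w).2 ⟨n, h⟩⟩
    clear h
    induction w using List.reverseRecOn with
    | nil => exact .refl _
    | append_singleton w x ih =>
      rw [List.foldl_append]
      exact ih.trans (.read (mStep_step _ (foldl_stack_ne_nil _ _) x) (.refl _))

/-- Token `i` guesses `i`. Together the tokens cover all runs, since every run is determined by its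
word and one guess. -/
lemma multiplesPDA_isExplorable : (multiplesPDA a b k).IsExplorable (k + 1) := by
  refine ⟨fun w i => w.foldl (mStep a b i) (multiplesPDA a b k).init, fun _ => rfl,
    fun w x i => ⟨_, .refl, ?_⟩, fun w hw => ?_⟩
  · rw [List.foldl_append]
    exact mStep_step i (foldl_stack_ne_nil _ _) x
  · obtain ⟨d, r, hd⟩ := hw
    obtain ⟨i, rfl, -⟩ := multiplesPDA_run r
    exact ⟨i, hd⟩

end MultiplesPDA

theorem multiplesLanguage_mem_ExplCFL {α : Type*} {a b : α} (hab : a ≠ b) (k : ℕ) :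
    multiplesLanguage a b (k + 1) ∈ ExplCFL (k + 1) α := by
  classical
  exact ⟨_, _, inferInstance, inferInstance, multiplesPDA a b k, multiplesPDA_isExplorable,
    multiplesPDA_language hab⟩

/-! ### Marking two acceptances on one run. -/

section Phase

variable {Q α Γ : Type*}

/-- The pushdown automaton that runs `P`, may change once from phase `false` to phase `true`, in an
accepting state of `P`, and accepts in phase `true`. The letters it reads carry the phase. -/
def phasePDA (P : PDA Q α Γ) : PDA (Q × Bool) (α × Bool) Γ where
  δ q x Z := {m | (∃ y : Option α, x = y.map (·, q.2) ∧ (m.1.1, m.2) ∈ P.δ q.1 y Z ∧ m.1.2 = q.2) ∨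
    (x = none ∧ q.2 = false ∧ q.1 ∈ P.accept ∧ m = ((q.1, true), [Z]))}
  push_le_two := by
    rintro q x Z m (⟨y, -, hm, -⟩ | ⟨-, -, -, rfl⟩)
    · exact P.push_le_two _ _ _ _ hm
    · simp
  start := (P.start, false)
  bottom := P.bottom
  accept := {q | q.1 ∈ P.accept ∧ q.2 = true}

variable {P : PDA Q α Γ}

lemma phasePDA_step {x : Option α} {c d : Q × List Γ} (h : P.Step x c d) (s : Bool) :
    (phasePDA P).Step (x.map (·, s)) ((c.1, s), c.2) ((d.1, s), d.2) := by
  obtain ⟨q, Z, γ, p, β, rfl, rfl, hm⟩ := h.exists_cons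
  exact .mk _ _ _ _ _ _ (.inl ⟨x, rfl, hm, rfl⟩)

lemma phasePDA_run {c d : Q × List Γ} {w : List α} (r : P.Run c w d) (s : Bool) :
    (phasePDA P).Run ((c.1, s), c.2) (w.map (·, s)) ((d.1, s), d.2) := by
  induction r with
  | refl => exact .refl _
  | eps h _ ih => exact .eps (phasePDA_step h s) ih
  | read h _ ih => exact .read (phasePDA_step h s) ih

lemma mem_phasePDA_language {c d : Q × List Γ} {u v : List α} (hu : P.Run P.init u c)
    (hc : c.1 ∈ P.accept) (hv : P.Run c v d) (hd : d.1 ∈ P.accept) (hv₀ : v ≠ []) :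
    u.map (·, false) ++ v.map (·, true) ∈ (phasePDA P).language := by
  -- The phase change is an `ε`-transition and needs a nonempty stack; reading the nonempty `v`
  -- afterwards guarantees it.
  have hne := hv.stack_ne_nil hv₀
  refine ⟨((d.1, true), d.2), (phasePDA_run hu false).trans (.eps (c' := ((c.1, true), c.2)) ?_
    (phasePDA_run hv true)), hd, rfl⟩
  obtain ⟨q, _ | ⟨Z, γ⟩⟩ := c
  · exact absurd rfl hne
  · exact .mk _ _ _ _ [Z] γ (.inr ⟨rfl, rfl, hc, rfl⟩)

lemma phasePDA_step_inv {x : Option (α × Bool)} {c d : (Q × Bool) × List Γ}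
    (h : (phasePDA P).Step x c d) :
    (∃ y : Option α, x = y.map (·, c.1.2) ∧ P.Step y (c.1.1, c.2) (d.1.1, d.2) ∧ d.1.2 = c.1.2) ∨
      (x = none ∧ c.1.2 = false ∧ c.1.1 ∈ P.accept ∧ d = ((c.1.1, true), c.2)) := by
  obtain ⟨q, Z, γ, p, β, rfl, rfl, hm⟩ := h.exists_cons
  rcases hm with ⟨y, rfl, hm, hp⟩ | ⟨rfl, h₁, h₂, hm⟩
  · exact .inl ⟨y, rfl, .mk _ _ _ _ _ _ hm, hp⟩
  · obtain ⟨rfl, rfl⟩ := Prod.mk.inj hm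
    exact .inr ⟨rfl, h₁, h₂, rfl⟩

lemma phasePDA_run_inv {c d : (Q × Bool) × List Γ} {w : List (α × Bool)}
    (r : (phasePDA P).Run c w d) (hd : d.1.2 = true) :
    (c.1.2 = true → ∃ v, w = v.map (·, true) ∧ P.Run (c.1.1, c.2) v (d.1.1, d.2)) ∧
    (c.1.2 = false → ∃ u v e, w = u.map (·, false) ++ v.map (·, true) ∧
      P.Run (c.1.1, c.2) u e ∧ e.1 ∈ P.accept ∧ P.Run e v (d.1.1, d.2)) := by
  have step : ∀ {x : Option (α × Bool)} {c c' d : (Q × Bool) × List Γ}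
      {w : List (α × Bool)},
      (phasePDA P).Step x c c' →
      ((c'.1.2 = true → ∃ v, w = v.map (·, true) ∧ P.Run (c'.1.1, c'.2) v (d.1.1, d.2)) ∧
      (c'.1.2 = false → ∃ u v e, w = u.map (·, false) ++ v.map (·, true) ∧
        P.Run (c'.1.1, c'.2) u e ∧ e.1 ∈ P.accept ∧ P.Run e v (d.1.1, d.2))) →
      (c.1.2 = true → ∃ v, x.toList ++ w = v.map (·, true) ∧
        P.Run (c.1.1, c.2) v (d.1.1, d.2)) ∧
      (c.1.2 = false → ∃ u v e, x.toList ++ w = u.map (·, false) ++ v.map (·, true) ∧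
        P.Run (c.1.1, c.2) u e ∧ e.1 ∈ P.accept ∧ P.Run e v (d.1.1, d.2)) := by
    intro x c c' d w h ⟨ih₁, ih₂⟩
    rcases phasePDA_step_inv h with ⟨y, rfl, hs, hp⟩ | ⟨rfl, h₁, h₂, rfl⟩
    · refine ⟨fun hc => ?_, fun hc => ?_⟩
      · obtain ⟨v, rfl, r⟩ := ih₁ (hp.trans hc)
        exact ⟨y.toList ++ v, by cases y <;> simp [hc], hs.run r⟩
      · obtain ⟨u, v, e, rfl, r, he, r'⟩ := ih₂ (hp.trans hc)
        exact ⟨y.toList ++ u, v, e, by cases y <;> simp [hc], hs.run r, he, r'⟩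
    · refine ⟨fun hc => by simp [hc] at h₁, fun _ => ?_⟩
      obtain ⟨v, rfl, r⟩ := ih₁ rfl
      exact ⟨[], v, _, by simp, .refl _, h₂, r⟩
  induction r with
  | refl c => exact ⟨fun _ => ⟨[], rfl, .refl _⟩, fun h => by simp [h] at hd⟩
  | eps h _ ih => exact step h (ih hd)
  | read h _ ih => exact step h (ih hd)

/-- These two memberships suffice for the counting on pumped words; that one run links them is used
only to place the original word in the language. -/
lemma exists_of_mem_phasePDA_language {w : List (α × Bool)} (hw : w ∈ (phasePDA P).language) :
    ∃ u v : List α, w = u.map (·, false) ++ v.map (·, true) ∧ u ∈ P.language ∧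
      u ++ v ∈ P.language := by
  obtain ⟨d, r, hd⟩ := hw
  obtain ⟨u, v, e, rfl, h₁, he, h₂⟩ := (phasePDA_run_inv r hd.2).2 rfl
  exact ⟨u, v, rfl, ⟨e, h₁, he⟩, ⟨_, h₁.trans h₂, hd.1⟩⟩

lemma PDA.IsWinningStrategy.run {k : ℕ} {σ : List α → Fin k → Q × List Γ}
    (hσ : P.IsWinningStrategy k σ) (u v : List α) (l : Fin k) :
    P.Run (σ u l) v (σ (u ++ v) l) := by
  induction v using List.reverseRecOn with
  | nil => simpa using PDA.Run.refl _
  | append_singleton v x ih =>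
    rw [← List.append_assoc]
    exact ih.trans (hσ.move _ x l).run

end Phase

/-! ### No `k`-explorable automaton recognises the witness language. -/

section LowerBound

variable {α : Type*}

lemma countP_flatten_replicate (f : α → Bool) (t : ℕ) (l : List α) :
    (List.replicate t l).flatten.countP f = t * l.countP f := by
  induction t with
  | zero => simp
  | succ t ih => rw [List.replicate_succ, List.flatten_cons, List.countP_append, ih]; ring

lemma lt_length_of_getElem?_append {l₁ l₂ : List α} {r : ℕ} {e : α} (h : (l₁ ++ l₂)[r]? = some e)
    (he : e ∉ l₂) : r < l₁.length := by
  by_contra! hr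
  rw [List.getElem?_append_right hr] at h
  exact he (List.mem_of_getElem? h)

lemma length_le_of_getElem?_append {l₁ l₂ : List α} {r : ℕ} {e : α}
    (h : (l₁ ++ l₂)[r]? = some e) (he : e ∉ l₁) : l₁.length ≤ r := by
  by_contra! hr
  rw [List.getElem?_append_left hr] at h
  exact he (List.mem_of_getElem? h)

/-- If `aⁿ b^{i n} v` is in `multiplesLanguage a b (k + 1)`, where `n, i ≥ 1`, then it has length at
most `(k + 2) n`, and `v` is empty or has at least `n` letters. -/
lemma multiplesLanguage_extension {a b : α} (hab : a ≠ b) {k n i : ℕ} (hn : 1 ≤ n) (hi : 1 ≤ i)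
    {v : List α} (h : (List.replicate n a ++ List.replicate (i * n) b) ++ v ∈
      multiplesLanguage a b (k + 1)) :
    n + i * n + v.length ≤ (k + 2) * n ∧ (v.length = 0 ∨ n ≤ v.length) := by
  classical
  obtain ⟨j, hj, m, h⟩ := h
  have hj' := (Finset.mem_Icc.1 hj).2
  have hpos : 0 < i * n := by positivity
  have hnm : n ≤ m := by
    have := congrArg (List.count a) h
    simp [List.count_replicate, hab.symm] at this
    omega
  have hmn : m ≤ n := by
    -- If `n < m`, position `n` would hold `b` on the left, as `i * n > 0`, but `a` on the right.
    by_contra! hlt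
    have := congrArg (fun l => l[n]?) h
    simp only [List.append_assoc] at this
    rw [List.getElem?_append_right (by simp), List.getElem?_append_left (by simpa using hpos),
      List.getElem?_append_left (by simpa using hlt)] at this
    simp [hlt, hpos, hab.symm] at this
  obtain rfl := le_antisymm hnm hmn
  have hl := congrArg List.length h
  simp only [List.length_append, List.length_replicate] at hl
  have h₁ := Nat.mul_le_mul_right n hj'
  refine ⟨by rw [hl]; linarith, ?_⟩
  rcases le_or_gt j i with hji | hij
  · have := Nat.mul_le_mul_right n hji
    omega
  · have := Nat.mul_le_mul_right n (Nat.succ_le_of_lt hij)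
    rw [Nat.succ_mul] at this
    omega

/-- If `P` recognises `multiplesLanguage`, then for some `n` no run of `P` accepts `aⁿ b^{i n}` and
afterwards `aⁿ b^{j n}`. -/
lemma exists_notMem_phasePDA_language {Q Γ : Type*} [Finite Q] [Finite Γ] {P : PDA Q α Γ}
    {a b : α} (hab : a ≠ b) {k : ℕ} (hP : P.language = multiplesLanguage a b (k + 1)) :
    ∃ n, 1 ≤ n ∧ ∀ i j : ℕ, 1 ≤ i → i < j →
      (List.replicate n a ++ List.replicate (i * n) b).map (·, false) ++
        (List.replicate ((j - i) * n) b).map (·, true) ∉ (phasePDA P).language := by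
  classical
  obtain ⟨p, hp⟩ := (phasePDA P).pumping
  refine ⟨p + 1, by omega, fun i j hi hij hW => ?_⟩
  -- The block of `i * n` letters `b` is then longer than any pumped window.
  set n := p + 1 with hn
  have bound : ∀ w ∈ (phasePDA P).language, 1 ≤ w.countP (· = (a, false)) →
      w.length ≤ (k + 2) * w.countP (· = (a, false)) ∧
        (w.countP (·.2) = 0 ∨ w.countP (· = (a, false)) ≤ w.countP (·.2)) := by
    intro w hw h
    obtain ⟨u, v, rfl, hu, huv⟩ := exists_of_mem_phasePDA_language hw
    rw [hP] at hu huv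
    obtain ⟨i, hi, m, rfl⟩ := hu
    have hA : ((List.replicate m a ++ List.replicate (i * m) b).map (·, false) ++
        v.map (·, true)).countP (· = (a, false)) = m := by
      simp [List.countP_replicate, hab.symm, List.countP_map, Function.comp_def]
    have hT : ((List.replicate m a ++ List.replicate (i * m) b).map (·, false) ++
        v.map (·, true)).countP (·.2) = v.length := by
      simp [List.countP_replicate, List.countP_map, Function.comp_def]
    rw [hA] at h
    rw [hA, hT]
    simpa [add_assoc] using multiplesLanguage_extension hab h (Finset.mem_Icc.1 hi).1 huv
  have hnin : n ≤ i * n := Nat.le_mul_of_pos_left n hi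
  have hnij : n ≤ (j - i) * n := Nat.le_mul_of_pos_left n (by omega)
  obtain ⟨u, v, x, y, z, hw, hpos, hlen, hpump⟩ := hp _ hW (by simp; omega)
  have hcount : ∀ (f : α × Bool → Bool) (t : ℕ),
      (u ++ ((List.replicate t v).flatten ++ (x ++ ((List.replicate t y).flatten ++ z)))).countP f =
        (u ++ (x ++ z)).countP f + t * (v ++ y).countP f := by
    intro f t
    simp only [List.countP_append, countP_flatten_replicate]
    ring
  have hcountW : ∀ f : α × Bool → Bool,
      ((List.replicate n a ++ List.replicate (i * n) b).map (·, false) ++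
        (List.replicate ((j - i) * n) b).map (·, true)).countP f =
        (u ++ (x ++ z)).countP f + (v ++ y).countP f := by
    intro f
    rw [hw]
    simp only [List.countP_append]
    ring
  have hAW := hcountW (· = (a, false))
  have hTW := hcountW (·.2)
  have hA : ((List.replicate n a ++ List.replicate (i * n) b).map (·, false) ++
      (List.replicate ((j - i) * n) b).map (·, true)).countP (· = (a, false)) = n := by
    simp [List.countP_replicate, hab.symm]
  have hT : ((List.replicate n a ++ List.replicate (i * n) b).map (·, false) ++
      (List.replicate ((j - i) * n) b).map (·, true)).countP (·.2) = (j - i) * n := by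
    simp [List.countP_replicate]
  rw [hA] at hAW
  rw [hT] at hTW
  rcases Nat.eq_zero_or_pos ((v ++ y).countP (· = (a, false))) with hA₀ | hA₁
  -- No `a` is pumped: their number stays `n` while the length exceeds `(k + 2) * n`.
  · have ht := hcount (· = (a, false)) ((k + 2) * n + 1)
    rw [hA₀, mul_zero, add_zero] at ht
    rw [hA₀, add_zero] at hAW
    have h := (bound _ (hpump ((k + 2) * n + 1)) (by omega)).1
    rw [ht, ← hAW, ← List.countP_true, hcount, List.countP_true] at h
    have := Nat.le_mul_of_pos_right ((k + 2) * n + 1) hpos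
    omega
  rcases Nat.eq_zero_or_pos ((v ++ y).countP (·.2)) with hT₀ | hT₁
  -- Some `a` but no second-phase letter is pumped: the `a`s outnumber the second phase, which stays
  -- nonempty at `(j - i) * n`.
  · rw [hT₀, add_zero] at hTW
    have ht := hcount (·.2) ((j - i) * n + 1)
    rw [hT₀, mul_zero, add_zero] at ht
    have ht' := hcount (· = (a, false)) ((j - i) * n + 1)
    have := Nat.le_mul_of_pos_right ((j - i) * n + 1) hA₁
    have h := (bound _ (hpump ((j - i) * n + 1)) (by omega)).2
    omega
  -- Both kinds are pumped: a window of length at most `p` would contain an `a` and a second-phase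
  -- letter, with the `i * n` first-phase `b`s between them.
  · obtain ⟨e, he, he'⟩ := List.countP_pos_iff.1 hA₁
    obtain ⟨f, hf, hf'⟩ := List.countP_pos_iff.1 hT₁
    obtain rfl : e = (a, false) := by simpa using he'
    have key : ∀ e ∈ v ++ y, ∃ r < (v ++ (x ++ y)).length,
        ((List.replicate n a ++ List.replicate (i * n) b).map (·, false) ++
          (List.replicate ((j - i) * n) b).map (·, true))[u.length + r]? = some e := by
      intro e he
      have he : e ∈ v ++ (x ++ y) := by
        simp only [List.mem_append] at he ⊢
        tauto
      obtain ⟨r, hr, rfl⟩ := List.mem_iff_getElem.1 he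
      refine ⟨r, hr, ?_⟩
      rw [hw, show v ++ (x ++ (y ++ z)) = (v ++ (x ++ y)) ++ z by simp,
        List.getElem?_append_right (by simp), Nat.add_sub_cancel_left,
        List.getElem?_append_left hr, List.getElem?_eq_getElem hr]
    obtain ⟨r, hr, h₁⟩ := key _ he
    obtain ⟨s, hs, h₂⟩ := key _ hf
    rw [List.map_append, List.append_assoc] at h₁
    have h₁ := lt_length_of_getElem?_append h₁ (by simp [hab])
    have h₂ := length_le_of_getElem?_append h₂ (by
      intro hm
      obtain ⟨g, -, rfl⟩ := List.mem_map.1 hm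
      simp at hf')
    simp only [List.length_map, List.length_append, List.length_replicate] at h₁ h₂ hr hs hlen
    omega

theorem multiplesLanguage_notMem_ExplCFL {a b : α} (hab : a ≠ b) (k : ℕ) :
    multiplesLanguage a b (k + 1) ∉ ExplCFL k α := by
  rintro ⟨Q, Γ, hQ, hΓ, P, ⟨σ, hσ⟩, hP⟩
  obtain ⟨n, hn₁, hn⟩ := exists_notMem_phasePDA_language hab hP
  let u : ℕ → List α := fun i => List.replicate n a ++ List.replicate (i * n) b
  have hu : ∀ i : Fin (k + 1), ∃ l, (σ (u (i + 1)) l).1 ∈ P.accept := fun i =>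
    hσ.wins _ (hP ▸ ⟨i + 1, by simp; omega, n, rfl⟩)
  choose l hl using hu
  -- There are `k + 1` accepted prefixes of one play but only `k` tokens.
  obtain ⟨i, j, hij, hlij⟩ : ∃ i j : Fin (k + 1), i < j ∧ l i = l j := by
    obtain ⟨i, j, hne, h⟩ := Fintype.exists_ne_map_eq_of_card_lt l (by simp)
    rcases lt_or_gt_of_ne hne with hlt | hlt
    · exact ⟨i, j, hlt, h⟩
    · exact ⟨j, i, hlt, h.symm⟩
  have hij' : (i : ℕ) < j := hij
  have huv : u (i + 1) ++ List.replicate ((j + 1 - (i + 1)) * n) b = u (j + 1) := by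
    simp only [u, List.append_assoc, List.replicate_append_replicate, ← add_mul]
    rw [Nat.add_sub_cancel' (by omega)]
  have hv := hσ.run (u (i + 1)) (List.replicate ((j + 1 - (i + 1)) * n) b) (l i)
  rw [huv] at hv
  have h₀ := hσ.run [] (u (i + 1)) (l i)
  rw [hσ.init, List.nil_append] at h₀
  refine hn (i + 1) (j + 1) (by omega) (by omega)
    (mem_phasePDA_language h₀ (hl i) hv (hlij ▸ hl j) fun h => ?_)
  have : 0 < (j + 1 - (i + 1) : ℕ) * n := Nat.mul_pos (by omega) hn₁
  have := congrArg List.length h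
  simp only [List.length_replicate, List.length_nil] at this
  omega

end LowerBound

end Explorability

theorem mainTheorem1 {α : Type*} [Finite α] (k : ℕ) :
    (Explorability.ExplCFL k α ⊆ Explorability.ExplCFL (k + 1) α ∧
      Explorability.ExplCFL (k + 1) α ⊆ Explorability.CFL α) ∧
    ∀ a b : α, a ≠ b →
      (Explorability.ExplCFL k α ⊂ Explorability.ExplCFL (k + 1) α ∧
        Explorability.ExplCFL (k + 1) α ⊂ Explorability.CFL α) ∧
      Explorability.multiplesLanguage a b (k + 1) ∈ Explorability.ExplCFL (k + 1) α ∧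
      Explorability.multiplesLanguage a b (k + 1) ∉ Explorability.ExplCFL k α := by
  open Explorability in
  refine ⟨⟨ExplCFL_subset_succ k α, ExplCFL_subset_CFL (k + 1)⟩, fun a b hab => ?_⟩
  have strict : ∀ m, multiplesLanguage a b (m + 1) ∈ ExplCFL (m + 1) α ∧
      multiplesLanguage a b (m + 1) ∉ ExplCFL m α := fun m =>
    ⟨multiplesLanguage_mem_ExplCFL hab m, multiplesLanguage_notMem_ExplCFL hab m⟩
  refine ⟨⟨⟨ExplCFL_subset_succ k α, fun h => (strict k).2 (h (strict k).1)⟩,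
    ExplCFL_subset_CFL (k + 1), fun h => ?_⟩, strict k⟩
  -- The witness of level `k + 2` is context-free but not in level `k + 1`.
  exact (strict (k + 1)).2 (h (ExplCFL_subset_CFL _ (strict (k + 1)).1))
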